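/- Let $W$ be the Watkins snark: the cubic graph on the $50$ vertices $a_1,\dots,a_{25},b_1,\dots,b_{25}$ whose edges are those of the $25$-cycle $a_1a_2\cdots a_{25}a_1$, the $25$ edges $a_ib_i$, and the edges of the five $5$-cycles $b_1b_3b_{20}b_2b_{19}b_1$, $b_{25}b_7b_{24}b_6b_8b_{25}$, $b_4b_{11}b_{13}b_5b_{12}b_4$, $b_{23}b_{21}b_{14}b_{22}b_{15}b_{23}$ and $b_{18}b_{10}b_{17}b_9b_{16}b_{18}$. A configuration on a graph $G$ is a function $C:V(G)\to\mathbb{N}$ (here $0\in\mathbb N$), and its size is $\sum_v C(v)$. A pebbling move removes two pebbles from a vertex and places one pebble on an adjacent vertex. For a vertex $r$, $C$ is $r$-solvable if some (possibly empty) sequence of pebbling moves starting from $C$ places a pebble on $r$, and $r$-unsolvable otherwise. Let $\pi(G,r)$ be the least $t$ such that every configuration of size $t$ is $r$-solvable, and let $\pi(G)=\max_r\pi(G,r)$ be the pebbling number of $G$. Then there is a set $S$ of $12$ vertices of $W$, with $a_{13},a_{14}\notin S$, such that the configuration with $85$ pebbles on each of $a_{13}$ and $a_{14}$, one pebble on each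 vertex of $S$, and no other pebbles, which has size $182$, is $a_1$-unsolvable. Moreover, $\pi(W)\ge 183$. -/

import Mathlib

/-! Graph pebbling. A configuration on a graph with vertex set `V` is a function `C : V → ℕ`. -/

/-- `PebblingMove G C C'`: the configuration `C'` arises from `C` by removing two pebbles from a
vertex `u` and placing one pebble on a vertex `v` adjacent to `u`. -/
def PebblingMove {V : Type*} [DecidableEq V] (G : SimpleGraph V) (C C' : V → ℕ) : Prop :=
  ∃ u v : V, G.Adj u v ∧ 2 ≤ C u ∧
    C' = Function.update (Function.update C u (C u - 2)) v (C v + 1)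

/-- `C` is `r`-solvable: some (possibly empty) sequence of pebbling moves leads from `C` to a
configuration with a pebble on `r`. -/
def PebblingSolvable {V : Type*} [DecidableEq V] (G : SimpleGraph V) (r : V) (C : V → ℕ) : Prop :=
  ∃ C' : V → ℕ, Relation.ReflTransGen (PebblingMove G) C C' ∧ 1 ≤ C' r

/-- The size of a configuration: its total number of pebbles. -/
def configSize {V : Type*} [Fintype V] (C : V → ℕ) : ℕ := ∑ v, C v

/-- `π(G, r)`: the minimum `t` such that every configuration of size `t` is `r`-solvable. -/
noncomputable def rootedPebblingNumber {V : Type*} [Fintype V] [DecidableEq V]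
    (G : SimpleGraph V) (r : V) : ℕ :=
  sInf {t : ℕ | ∀ C : V → ℕ, configSize C = t → PebblingSolvable G r C}

/-- `π(G) = max_r π(G, r)`. -/
noncomputable def pebblingNumber {V : Type*} [Fintype V] [DecidableEq V]
    (G : SimpleGraph V) : ℕ :=
  Finset.univ.sup (rootedPebblingNumber G)

/-- The 50 vertices of the Watkins snark: `a i` and `b i`, the index `i` being read modulo 25
(so that `a 25 = a 0` and `b 25 = b 0`). -/
inductive WatkinsVertex : Type
  | a (i : ZMod 25) : WatkinsVertex
  | b (i : ZMod 25) : WatkinsVertex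
  deriving DecidableEq, Fintype

/-- The five 5-cycles on the vertices `b 1, …, b 25`, as a list of 25 pairs of indices. -/
def watkinsInnerEdges : List (ZMod 25 × ZMod 25) :=
  [(1, 3), (3, 20), (20, 2), (2, 19), (19, 1),
   (25, 7), (7, 24), (24, 6), (6, 8), (8, 25),
   (4, 11), (11, 13), (13, 5), (5, 12), (12, 4),
   (23, 21), (21, 14), (14, 22), (22, 15), (15, 23),
   (18, 10), (10, 17), (17, 9), (9, 16), (16, 18)]

/-- The edges of the Watkins snark, each listed in one direction. -/
def watkinsEdge : WatkinsVertex → WatkinsVertex → Prop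
  | .a i, .a j => j = i + 1
  | .a i, .b j => i = j
  | .b i, .b j => (i, j) ∈ watkinsInnerEdges
  | .b _, .a _ => False

/-- The Watkins snark `W`: the 25-cycle `a 1, a 2, …, a 25, a 1`, five disjoint 5-cycles on the
`b i`, and the perfect matching `a i — b i`. -/
def watkinsSnark : SimpleGraph WatkinsVertex := SimpleGraph.fromRel watkinsEdge

/-- The configuration with `85` pebbles on each of `a 13` and `a 14`, one pebble on every other
vertex of `S`, and no other pebbles. -/
def watkinsConfig (S : Finset WatkinsVertex) : WatkinsVertex → ℕ := fun v =>
  if v = .a 13 ∨ v = .a 14 then 85 else if v ∈ S then 1 else 0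

/-! ### Flows of pebbling moves -/

/-! Unsolvability is certified by linear inequalities on the move counts `f u v`. Weighting the
vertex balances by `y`, and the rounding facts "out ≤ in" by `z ≥ 0`, bounds a combination of the `f
u v`, as in linear programming duality. No single certificate is used. Four are combined, with
integer rounding in between, on the three counts `x = f (a 2) (a 1)`, `q = f (a 25) (a 1)` and `s =
f (a 24) (a 25)`. The bound on `π(W)` follows because solvability is monotone in the configuration.
-/

/-- Counting the moves along each directed edge turns a sequence of pebbling moves into a flow
which consumes two pebbles at the tail of an edge for each pebble delivered at its head. -/
theorem exists_flow_of_reflTransGen {V : Type*} [Fintype V] [DecidableEq V] {G : SimpleGraph V}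
    {C D : V → ℕ} (h : Relation.ReflTransGen (PebblingMove G) C D) :
    ∃ f : V → V → ℕ, (∀ u v, f u v ≠ 0 → G.Adj u v) ∧
      ∀ v, C v + ∑ u, f u v = D v + 2 * ∑ u, f v u := by
  induction h with
  | refl => exact ⟨fun _ _ => 0, by simp, by simp⟩
  | tail _ hmove ih =>
    obtain ⟨f, hadj, hbal⟩ := ih
    obtain ⟨u, v, huv, hu, rfl⟩ := hmove
    have hne : u ≠ v := huv.ne
    refine ⟨fun x w => f x w + if x = u then (if w = v then 1 else 0) else 0, ?_, ?_⟩
    · intro x w hxw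
      by_cases hx : x = u
      · by_cases hw : w = v
        · rwa [hx, hw]
        · exact hadj x w (by simpa [hw] using hxw)
      · exact hadj x w (by simpa [hx] using hxw)
    · intro w
      have hw := hbal w
      simp only [Finset.sum_add_distrib, Finset.sum_ite_eq', Finset.mem_univ, if_true]
      by_cases hwu : w = u
      · subst hwu
        simp [hne]
        omega
      · by_cases hwv : w = v
        · subst hwv
          simp [hwu]
          omega
        · simp [hwu, hwv]
          omega

/-- A weighted count of the moves of a flow. Besides the balance at each vertex it uses, with
weight `z`, that a vertex carrying at most one pebble emits at most as many units as it receives. -/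
theorem sum_mul_flow_le {V : Type*} [Fintype V] {G : SimpleGraph V} {C D : V → ℕ}
    {f : V → V → ℕ} (hadj : ∀ u v, f u v ≠ 0 → G.Adj u v)
    (hbal : ∀ v, C v + ∑ u, f u v = D v + 2 * ∑ u, f v u)
    {y z : V → ℤ} {m : V → V → ℤ} (hz : ∀ v, 0 ≤ z v)
    (hzC : ∀ v, z v ≠ 0 → C v ≤ 1)
    (hm : ∀ u v, G.Adj u v → m u v ≤ 2 * y u + z u - y v - z v) :
    ∑ u, ∑ v, m u v * f u v ≤ ∑ v, y v * C v - ∑ v, y v * D v := by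
  have h₁ : ∑ u, ∑ v, m u v * (f u v : ℤ) ≤
      ∑ u, ∑ v, ((2 * y u + z u) * (f u v : ℤ) - (y v + z v) * f u v) := by
    refine Finset.sum_le_sum fun u _ => Finset.sum_le_sum fun v _ => ?_
    by_cases h : f u v = 0
    · simp [h]
    · have := mul_le_mul_of_nonneg_right (hm u v (hadj u v h)) (Int.natCast_nonneg (f u v))
      linarith
  have h₂ : ∑ u, ∑ v, ((2 * y u + z u) * (f u v : ℤ) - (y v + z v) * f u v) =
      ∑ v, ((2 * y v + z v) * ∑ u, (f v u : ℤ) - (y v + z v) * ∑ u, (f u v : ℤ)) := by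
    simp only [Finset.sum_sub_distrib, Finset.mul_sum]
    rw [Finset.sum_comm (f := fun u v => (y v + z v) * (f u v : ℤ))]
  rw [← Finset.sum_sub_distrib]
  refine h₁.trans (h₂.le.trans (Finset.sum_le_sum fun v _ => ?_))
  have hb : (C v : ℤ) + ∑ u, (f u v : ℤ) = D v + 2 * ∑ u, (f v u : ℤ) := by
    exact_mod_cast hbal v
  have hle : z v * (∑ u, (f v u : ℤ)) ≤ z v * ∑ u, (f u v : ℤ) := by
    by_cases h : z v = 0
    · simp [h]
    · refine mul_le_mul_of_nonneg_left ?_ (hz v)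
      have := hzC v h
      have hin : 0 ≤ ∑ u, (f u v : ℤ) := by positivity
      have hout : 0 ≤ ∑ u, (f v u : ℤ) := by positivity
      -- Integrality enters here: `2 * out ≤ 1 + in` forces `out ≤ in`, which fails over the
      -- rationals.
      omega
  have hy : y v * ((C v : ℤ) + ∑ u, (f u v : ℤ)) = y v * (D v + 2 * ∑ u, (f v u : ℤ)) := by
    rw [hb]
  linarith

/-! ### Solvability and the rooted pebbling number -/

theorem exists_pebblingMove_of_le {V : Type*} [DecidableEq V] {G : SimpleGraph V}
    {C C' D : V → ℕ} (hCD : C ≤ D) (h : PebblingMove G C C') :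
    ∃ D', PebblingMove G D D' ∧ C' ≤ D' := by
  obtain ⟨u, v, huv, hu, rfl⟩ := h
  refine ⟨_, ⟨u, v, huv, hu.trans (hCD u), rfl⟩, fun w => ?_⟩
  have hw := hCD w
  have hu' := hCD u
  have hv := hCD v
  by_cases hwv : w = v <;> by_cases hwu : w = u <;> simp [Function.update_apply, hwv, hwu] <;> grind

theorem PebblingSolvable.mono {V : Type*} [DecidableEq V] {G : SimpleGraph V} {r : V}
    {C D : V → ℕ} (hCD : C ≤ D) (h : PebblingSolvable G r C) : PebblingSolvable G r D := by
  obtain ⟨C', hC, hr⟩ := h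
  suffices ∃ D', Relation.ReflTransGen (PebblingMove G) D D' ∧ C' ≤ D' by
    obtain ⟨D', hD, hle⟩ := this
    exact ⟨D', hD, hr.trans (hle r)⟩
  clear hr
  induction hC with
  | refl => exact ⟨D, .refl, hCD⟩
  | tail _ hmove ih =>
    obtain ⟨D', hD, hle⟩ := ih
    obtain ⟨D'', hmove', hle'⟩ := exists_pebblingMove_of_le hle hmove
    exact ⟨D'', hD.tail hmove', hle'⟩

theorem exists_le_configSize_eq {V : Type*} [Fintype V] [DecidableEq V] (C : V → ℕ) {t : ℕ}
    (ht : t ≤ configSize C) : ∃ D ≤ C, configSize D = t := by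
  induction ht using Nat.decreasingInduction with
  | self => exact ⟨C, le_rfl, rfl⟩
  | of_succ t _ ih =>
    obtain ⟨D, hD, hsize⟩ := ih
    obtain ⟨v, hv⟩ : ∃ v, D v ≠ 0 := by
      by_contra! h
      simp [configSize, h] at hsize
    refine ⟨Function.update D v (D v - 1), fun w => ?_, ?_⟩
    · have : D w ≤ C w := hD w
      simp only [Function.update_apply]
      split_ifs with h
      · subst h
        omega
      · exact this
    · have h₁ := Finset.sum_update_of_mem (Finset.mem_univ v) D (D v - 1)
      have h₂ := Finset.sum_eq_add_sum_sdiff_singleton_of_mem (Finset.mem_univ v) D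
      unfold configSize at hsize ⊢
      omega

/-- `n` pebbles can be moved across an edge from a vertex carrying at least `2 * n` pebbles. -/
theorem exists_reflTransGen_of_adj {V : Type*} [DecidableEq V] {G : SimpleGraph V} {u w : V}
    (huw : G.Adj u w) (n : ℕ) (C : V → ℕ) (hC : 2 * n ≤ C u) :
    ∃ D, Relation.ReflTransGen (PebblingMove G) C D ∧ n ≤ D w := by
  -- The induction must also track how many pebbles remain on `u`.
  suffices ∃ D, Relation.ReflTransGen (PebblingMove G) C D ∧ n ≤ D w ∧ C u ≤ D u + 2 * n by
    obtain ⟨D, h, hn, -⟩ := this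
    exact ⟨D, h, hn⟩
  induction n with
  | zero => exact ⟨C, .refl, by simp, by simp⟩
  | succ n ih =>
    obtain ⟨D, h, hn, hu⟩ := ih (by omega)
    refine ⟨_, h.tail ⟨u, w, huw, by omega, rfl⟩, ?_, ?_⟩
    · simp [hn]
    · simp [huw.ne]
      omega

theorem pebblingSolvable_of_walk {V : Type*} [DecidableEq V] {G : SimpleGraph V} {u r : V}
    (p : G.Walk u r) (C : V → ℕ) (hC : 2 ^ p.length ≤ C u) : PebblingSolvable G r C := by
  induction p generalizing C with
  | nil => exact ⟨C, .refl, by simpa using hC⟩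
  | cons h p ih =>
    obtain ⟨D, hCD, hD⟩ := exists_reflTransGen_of_adj h (2 ^ p.length) C
      (by rwa [← pow_succ'])
    obtain ⟨D', hDD', hr⟩ := ih D hD
    exact ⟨D', hCD.trans hDD', hr⟩

theorem SimpleGraph.Connected.pebblingSolvable_of_le_configSize {V : Type*} [Fintype V]
    [DecidableEq V] {G : SimpleGraph V} (hG : G.Connected) (r : V) (C : V → ℕ)
    (hC : Fintype.card V * 2 ^ Fintype.card V ≤ configSize C) : PebblingSolvable G r C := by
  have : Nonempty V := ⟨r⟩
  obtain ⟨u, -, hu⟩ := Finset.exists_le_of_sum_le (s := Finset.univ)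
    (f := fun _ => 2 ^ Fintype.card V) (g := C) Finset.univ_nonempty
    (by simpa [configSize] using hC)
  obtain ⟨p, hp⟩ := (hG.preconnected u r).exists_isPath
  exact pebblingSolvable_of_walk p C
    ((Nat.pow_le_pow_right two_pos hp.length_lt.le).trans hu)

/-- If `π(G, r)` were at most the size of `C`, discarding pebbles would give a solvable
configuration of size exactly `π(G, r)` below `C`, making `C` solvable. -/
theorem SimpleGraph.Connected.configSize_lt_pebblingNumber {V : Type*} [Fintype V]
    [DecidableEq V] {G : SimpleGraph V} (hG : G.Connected) {r : V} {C : V → ℕ}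
    (hC : ¬ PebblingSolvable G r C) : configSize C < pebblingNumber G := by
  refine lt_of_lt_of_le ?_ (Finset.le_sup (f := rootedPebblingNumber G) (Finset.mem_univ r))
  -- Without this, `sInf` could take its default value `0` on the empty set.
  have hne : {t : ℕ | ∀ C : V → ℕ, configSize C = t → PebblingSolvable G r C}.Nonempty :=
    ⟨_, fun C h => hG.pebblingSolvable_of_le_configSize r C h.ge⟩
  by_contra! hle
  obtain ⟨D, hD, hsize⟩ := exists_le_configSize_eq C hle
  exact hC (PebblingSolvable.mono hD (Nat.sInf_mem hne D hsize))

/-! ### The Watkins snark -/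

theorem watkinsSnark_connected : watkinsSnark.Connected := by
  have hstep (i : ZMod 25) : watkinsSnark.Adj (.a i) (.a (i + 1)) := by
    simp [watkinsSnark, watkinsEdge, show (1 : ZMod 25) ≠ 0 by decide]
  have hrung (i : ZMod 25) : watkinsSnark.Adj (.a i) (.b i) := by
    simp [watkinsSnark, watkinsEdge]
  have hnat (n : ℕ) : watkinsSnark.Reachable (.a 0) (.a n) := by
    induction n with
    | zero => simp
    | succ n ih => simpa using ih.trans (hstep n).reachable
  have ha (i : ZMod 25) : watkinsSnark.Reachable (.a 0) (.a i) := by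
    simpa using hnat i.val
  refine SimpleGraph.connected_iff_exists_forall_reachable _ |>.2 ⟨.a 0, ?_⟩
  rintro (i | i)
  · exact ha i
  · exact (ha i).trans (hrung i).reachable

/-- The function on the vertices of the Watkins snark with the given tables of values, which both
start at the index `0`, that is, at `25`. -/
def watkinsTable (α β : Fin 25 → ℤ) : WatkinsVertex → ℤ
  | .a i => α i
  | .b i => β i

/-- A set of vertices on which pebbles do not help to reach `a 1` from `a 13` and `a 14`. -/
def idleVertices : Finset WatkinsVertex :=
  {.a 6, .a 7, .a 9, .a 10, .a 17, .b 3, .b 8, .b 9, .b 10, .b 16, .b 17, .b 18}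

theorem forall_watkinsSnark_adj {P : WatkinsVertex → WatkinsVertex → Prop}
    (haa : ∀ i, P (.a i) (.a (i + 1)) ∧ P (.a (i + 1)) (.a i))
    (hab : ∀ i, P (.a i) (.b i) ∧ P (.b i) (.a i))
    (hbb : ∀ e ∈ watkinsInnerEdges, P (.b e.1) (.b e.2) ∧ P (.b e.2) (.b e.1))
    (u v : WatkinsVertex) (h : watkinsSnark.Adj u v) : P u v := by
  obtain ⟨-, h⟩ := (SimpleGraph.fromRel_adj _ _ _).1 h
  rcases u with i | i <;> rcases v with j | j <;> simp only [watkinsEdge, or_false, false_or] at h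
  · rcases h with rfl | rfl
    exacts [(haa _).1, (haa _).2]
  · subst h
    exact (hab _).1
  · subst h
    exact (hab _).2
  · rcases h with h | h
    exacts [(hbb _ h).1, (hbb _ h).2]

/-- The value `p` on the directed edge `a 2 → a 1`, `q` on `a 25 → a 1`, `s` on `a 24 → a 25`. -/
def edgeTable (p q s : ℤ) (u v : WatkinsVertex) : ℤ :=
  (if u = .a 2 then if v = .a 1 then p else 0 else 0) +
    (if u = .a 25 then if v = .a 1 then q else 0 else 0) +
    if u = .a 24 then if v = .a 25 then s else 0 else 0

theorem sum_edgeTable_mul (p q s : ℤ) (f : WatkinsVertex → WatkinsVertex → ℕ) :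
    ∑ u, ∑ v, edgeTable p q s u v * f u v =
      p * f (.a 2) (.a 1) + q * f (.a 25) (.a 1) + s * f (.a 24) (.a 25) := by
  simp [edgeTable, add_mul, Finset.sum_add_distrib, ite_mul]

/-- Reduces a dual certificate to finite checks on the edges. The term `- α 1` in `c` accounts for
the pebble reaching `a 1`; all other final pebbles are dropped, as `y ≥ 0`. Only `a 13` and `a 14`
carry more than one pebble, so `z` need vanish only there. -/
theorem edgeTable_flow_le {D : WatkinsVertex → ℕ} {f : WatkinsVertex → WatkinsVertex → ℕ}
    (hadj : ∀ u v, f u v ≠ 0 → watkinsSnark.Adj u v)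
    (hbal : ∀ v, watkinsConfig idleVertices v + ∑ u, f u v = D v + 2 * ∑ u, f v u)
    (hD : 1 ≤ D (.a 1)) (α β γ δ : Fin 25 → ℤ) (p q s c : ℤ)
    (hc : ∑ v, watkinsTable α β v * watkinsConfig idleVertices v - α 1 = c)
    (hy : ∀ i, 0 ≤ α i ∧ 0 ≤ β i) (hz : ∀ i, 0 ≤ γ i ∧ 0 ≤ δ i)
    (hγ : γ 13 = 0 ∧ γ 14 = 0)
    (hm : ∀ P, P = (fun u v => edgeTable p q s u v ≤ 2 * watkinsTable α β u +
        watkinsTable γ δ u - watkinsTable α β v - watkinsTable γ δ v) →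
      (∀ i, P (.a i) (.a (i + 1)) ∧ P (.a (i + 1)) (.a i)) ∧
      (∀ i, P (.a i) (.b i) ∧ P (.b i) (.a i)) ∧
      ∀ e ∈ watkinsInnerEdges, P (.b e.1) (.b e.2) ∧ P (.b e.2) (.b e.1)) :
    p * f (.a 2) (.a 1) + q * f (.a 25) (.a 1) + s * f (.a 24) (.a 25) ≤ c := by
  subst hc
  obtain ⟨h₁, h₂, h₃⟩ := hm _ rfl
  have h0 : ∀ v, 0 ≤ watkinsTable α β v := by
    rintro (i | i)
    exacts [(hy i).1, (hy i).2]
  have hle := sum_mul_flow_le hadj hbal (y := watkinsTable α β) (z := watkinsTable γ δ)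
    (m := edgeTable p q s) (by rintro (i | i); exacts [(hz i).1, (hz i).2]) ?_
    (forall_watkinsSnark_adj h₁ h₂ h₃)
  · rw [sum_edgeTable_mul] at hle
    have h₄ : α 1 ≤ watkinsTable α β (.a 1) * D (.a 1) :=
      le_mul_of_one_le_right (h0 (.a 1)) (by exact_mod_cast hD)
    have h₅ := Finset.single_le_sum (f := fun v => watkinsTable α β v * (D v : ℤ))
      (fun v _ => mul_nonneg (h0 v) (Int.natCast_nonneg _)) (Finset.mem_univ (.a 1))
    linarith
  · intro v hv
    have h₁₃ : v ≠ .a 13 := by rintro rfl; exact hv hγ.1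
    have h₁₄ : v ≠ .a 14 := by rintro rfl; exact hv hγ.2
    simp only [watkinsConfig, h₁₃, h₁₄, or_self, if_false]
    split_ifs <;> simp

theorem not_pebblingSolvable_watkinsConfig :
    ¬ PebblingSolvable watkinsSnark (.a 1) (watkinsConfig idleVertices) := by
  rintro ⟨D, hD, hr⟩
  obtain ⟨f, hadj, hbal⟩ := exists_flow_of_reflTransGen hD
  have hle := edgeTable_flow_le hadj hbal hr
  -- `192 x ≤ 191`, so `x = 0`.
  have h1 := hle
    ![32, 64, 128, 64, 32, 16, 0, 0, 8, 0, 0, 4, 4, 2, 1, 2, 4, 0, 8, 16, 16, 8, 4, 8, 16]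
    ![16, 32, 64, 0, 16, 8, 8, 8, 0, 0, 0, 8, 8, 4, 2, 2, 0, 0, 0, 32, 32, 4, 2, 4, 8]
    ![0, 0, 0, 0, 0, 0, 16, 16, 0, 8, 8, 0, 0, 0, 0, 0, 0, 8, 0, 0, 0, 0, 0, 0, 0]
    ![0, 0, 0, 64, 0, 0, 0, 0, 16, 8, 8, 0, 0, 0, 0, 0, 8, 8, 8, 0, 0, 0, 0, 0, 0]
    (192) (0) (0) (191) (by decide +kernel)
    (by decide) (by decide) (by decide) (by rintro _ rfl; decide +kernel)
  -- `48 q + 96 s ≤ 239 < 240`, so `q + 2 s ≤ 4`.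
  have h2 := hle
    ![32, 16, 8, 4, 4, 8, 0, 0, 8, 0, 0, 4, 2, 1, 2, 4, 4, 0, 4, 2, 4, 8, 16, 32, 64]
    ![16, 8, 4, 0, 2, 4, 16, 16, 0, 0, 0, 2, 2, 2, 4, 8, 0, 0, 0, 4, 4, 8, 8, 16, 32]
    ![0, 0, 0, 0, 0, 0, 16, 16, 0, 8, 8, 0, 0, 0, 0, 0, 0, 8, 0, 0, 0, 0, 0, 0, 0]
    ![0, 0, 0, 8, 0, 0, 0, 0, 16, 8, 8, 0, 0, 0, 0, 0, 8, 8, 8, 0, 0, 0, 0, 0, 0]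
    (0) (48) (96) (239) (by decide +kernel)
    (by decide) (by decide) (by decide) (by rintro _ rfl; decide +kernel)
  -- `384 q - 192 s ≤ 186 < 192`, so `s ≥ 2 q`.
  have h3 := hle
    ![256, 128, 64, 32, 16, 8, 16, 32, 32, 16, 8, 4, 2, 1, 1, 2, 4, 0, 8, 16, 16, 8, 8, 16,
      32]
    ![128, 64, 32, 0, 8, 4, 32, 64, 64, 8, 0, 4, 4, 2, 2, 4, 0, 0, 0, 32, 32, 4, 4, 8, 32]
    ![0, 0, 0, 0, 0, 0, 0, 0, 0, 0, 0, 0, 0, 0, 0, 0, 0, 8, 0, 0, 0, 0, 0, 0, 0]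
    ![0, 0, 0, 64, 0, 0, 0, 0, 0, 0, 8, 0, 0, 0, 0, 0, 8, 8, 8, 0, 0, 0, 0, 0, 0]
    (0) (384) (-192) (186) (by decide +kernel)
    (by decide) (by decide) (by decide) (by rintro _ rfl; decide +kernel)
  -- `128 x + 248 q ≥ 6`, so some move enters `a 1` from `a 2` or `a 25`.
  have h4 := hle
    ![4, 256, 64, 32, 16, 8, 0, 0, 4, 0, 0, 4, 2, 1, 1, 2, 4, 8, 16, 32, 16, 8, 4, 2, 2]
    ![2, 128, 32, 64, 8, 4, 4, 4, 0, 0, 0, 4, 4, 2, 2, 1, 0, 0, 8, 64, 32, 4, 2, 2, 2]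
    ![0, 0, 0, 0, 0, 0, 8, 8, 0, 8, 8, 0, 0, 0, 0, 0, 0, 0, 0, 0, 0, 0, 0, 0, 0]
    ![0, 0, 0, 0, 0, 0, 0, 0, 4, 8, 8, 0, 0, 0, 0, 0, 8, 8, 0, 0, 0, 0, 0, 0, 0]
    (-128) (-248) (0) (-6) (by decide +kernel)
    (by decide) (by decide) (by decide) (by rintro _ rfl; decide +kernel)
  -- Now `x = 0` gives `q ≥ 1`, hence `s ≥ 2` and `q + 2 s ≥ 5`, a contradiction.
  omega

theorem configSize_watkinsConfig_idleVertices :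
    configSize (watkinsConfig idleVertices) = 182 := by
  decide +kernel

theorem theorem4 :
    (∃ S : Finset WatkinsVertex, S.card = 12 ∧ WatkinsVertex.a 13 ∉ S ∧ WatkinsVertex.a 14 ∉ S ∧
      configSize (watkinsConfig S) = 182 ∧
      ¬ PebblingSolvable watkinsSnark (WatkinsVertex.a 1) (watkinsConfig S)) ∧
    183 ≤ pebblingNumber watkinsSnark := by
  refine ⟨⟨idleVertices, by decide, by decide, by decide,
    configSize_watkinsConfig_idleVertices, not_pebblingSolvable_watkinsConfig⟩, ?_⟩
  have h := watkinsSnark_connected.configSize_lt_pebblingNumber not_pebblingSolvable_watkinsConfig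
  rw [configSize_watkinsConfig_idleVertices] at h
  exact h
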